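/- Let $m\ge 0$ be an integer and let $a_k,h_k:[0,\infty)\to\mathbb R$ ($k=1,\dots,m$) be Lebesgue measurable, with $a_k$ essentially bounded, $a_k(t)\ge 0$ for almost all $t\ge 0$, $h_k(t)\le t$ for all $t\ge 0$, and $\limsup_{t\to\infty}h_k(t)=\infty$. Consider the equation $$\dot x(t)+\sum_{k=1}^m a_k(t)\,x(h_k(t))=0,\qquad t\ge t_0, \tag{1}$$ with the initial conditions $x(t)=\varphi(t)$ for $t<t_0$ and $x(t_0)=x_0$, where $t_0\ge 0$, $x_0\in\mathbb R$ and $\varphi:(-\infty,t_0)\to\mathbb R$ is a bounded Borel measurable function. A solution is a function $x:\mathbb R\to\mathbb R$ that is locally absolutely continuous on $[t_0,\infty)$, satisfies the equation for almost all $t\ge t_0$ and satisfies the initial conditions. Equation (1) is called stable if for every $t_0\ge 0$ and $\varepsilon>0$ there is $\delta>0$ such that $\sup_{t<t_0}|\varphi(t)|+|x_0|<\delta$ implies $|x(t)|<\varepsilon$ for all $t\ge t_0$, for the solution $x$ with the initial data $\varphi,x_0$. It is called asymptotically stable if it is stable and, for every $t_0\ge 0$, all solutions tend to $0$ as $t\to\infty$.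 It is called (uniformly) exponentially stable if there are $M>0$ and $\mu>0$ such that for all $t_0\ge 0$ and all initial data $\varphi,x_0$ the solution satisfies $$|x(t)|\le M e^{-\mu(t-t_0)}\Bigl(|x_0|+\sup_{s<t_0}|\varphi(s)|\Bigr),\qquad t\ge t_0 .$$ Consider also the ordinary differential equation $$\dot x(t)+\Bigl(\sum_{k=1}^m a_k(t)\Bigr)x(t)=0, \tag{2}$$ which is the equation of type (1) with the single coefficient $\sum_k a_k$ and the single argument $h(t)=t$; the notions above apply to it as such. (i) If (1) is asymptotically stable, then (2) is asymptotically stable. (ii) If $\limsup_{t\to\infty}(t-h_k(t))<\infty$ for $k=1,\dots,m$ and (1) is exponentially stable, then (2) is exponentially stable. -/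

import Mathlib

open MeasureTheory Filter Topology

namespace DelayEq

/-- `φ` is an admissible initial function for the initial point `t₀`: a bounded Borel measurable
function on `(-∞, t₀)`. -/
structure IsInitialFunction (t₀ : ℝ) (φ : Set.Iio t₀ → ℝ) : Prop where
  measurable : Measurable φ
  bounded : ∃ C : ℝ, ∀ t, |φ t| ≤ C

/-- `x : ℝ → ℝ` is a solution of the initial value problem
`x'(t) + ∑ k, a k t * x (h k t) = 0` for `t ≥ t₀`, `x t = φ t` for `t < t₀`, `x t₀ = x₀`:
it is locally absolutely continuous on `[t₀, ∞)`, satisfies the equation at almost every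
`t ≥ t₀`, and satisfies the initial conditions. -/
structure IsSolution {m : ℕ} (a h : Fin m → ℝ → ℝ) (t₀ : ℝ) (φ : Set.Iio t₀ → ℝ) (x₀ : ℝ)
    (x : ℝ → ℝ) : Prop where
  absolutelyContinuous : ∀ T : ℝ, t₀ ≤ T → AbsolutelyContinuousOnInterval x t₀ T
  equation : ∀ᵐ t ∂(volume.restrict (Set.Ici t₀)), HasDerivAt x (-∑ k, a k t * x (h k t)) t
  initial_function : ∀ t : Set.Iio t₀, x t = φ t
  initial_value : x t₀ = x₀

/-- Stability of `x'(t) + ∑ k, a k t * x (h k t) = 0`. -/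
def Stable {m : ℕ} (a h : Fin m → ℝ → ℝ) : Prop :=
  ∀ t₀ : ℝ, 0 ≤ t₀ → ∀ ε : ℝ, 0 < ε → ∃ δ : ℝ, 0 < δ ∧
    ∀ (φ : Set.Iio t₀ → ℝ) (x₀ : ℝ) (x : ℝ → ℝ), IsInitialFunction t₀ φ →
      IsSolution a h t₀ φ x₀ x → (⨆ t, |φ t|) + |x₀| < δ → ∀ t : ℝ, t₀ ≤ t → |x t| < ε

/-- Asymptotic stability: stability, and all solutions, for every initial point, tend to zero. -/
def AsymptoticallyStable {m : ℕ} (a h : Fin m → ℝ → ℝ) : Prop :=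
  Stable a h ∧
    ∀ t₀ : ℝ, 0 ≤ t₀ → ∀ (φ : Set.Iio t₀ → ℝ) (x₀ : ℝ) (x : ℝ → ℝ), IsInitialFunction t₀ φ →
      IsSolution a h t₀ φ x₀ x → Tendsto x atTop (𝓝 0)

/-- (Uniform) exponential stability; the constants do not depend on the initial point. -/
def ExponentiallyStable {m : ℕ} (a h : Fin m → ℝ → ℝ) : Prop :=
  ∃ M : ℝ, 0 < M ∧ ∃ μ : ℝ, 0 < μ ∧ ∀ t₀ : ℝ, 0 ≤ t₀ →
    ∀ (φ : Set.Iio t₀ → ℝ) (x₀ : ℝ) (x : ℝ → ℝ), IsInitialFunction t₀ φ →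
      IsSolution a h t₀ φ x₀ x →
        ∀ t : ℝ, t₀ ≤ t → |x t| ≤ M * Real.exp (-μ * (t - t₀)) * (|x₀| + ⨆ s, |φ s|)

/-- The coefficient of the ordinary differential equation `x'(t) + (∑ k, a k t) * x t = 0`,
viewed as an equation with the single coefficient `∑ k, a k` and the single argument `t`. -/
def odeCoeff {m : ℕ} (a : Fin m → ℝ → ℝ) : Fin 1 → ℝ → ℝ := fun _ t => ∑ k, a k t

/-- The (undelayed) argument of an ordinary differential equation. -/
def odeArg : Fin 1 → ℝ → ℝ := fun _ t => t

end DelayEq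

namespace DelayEq

/-! Let `A` be the sum of the coefficients. By the explicit solution formula, (2) is asymptotically
stable once `∫ A` diverges, and exponentially stable once `∫ A` over all windows of some fixed
length has a positive lower bound. Both are forced by testing (1) on the solution with zero
prehistory and value 1 at `t₀`: as long as `∫ A` from `t₀` is at most 1/4, this solution cannot drop
below 2/3 (`two_thirds_le_of_integral_le`). A convergent `∫ A` would thus give a solution of (1) not
tending to 0, and a long window with small `∫ A` would violate the exponential bound. The test
solution comes from a contraction in an exponentially weighted sup norm
(`exists_integral_solution`). -/

theorem _root_.AbsolutelyContinuousOnInterval.congr {f g : ℝ → ℝ} {a b : ℝ}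
    (hf : AbsolutelyContinuousOnInterval f a b) (hfg : Set.EqOn f g (Set.uIcc a b)) :
    AbsolutelyContinuousOnInterval g a b := by
  refine Tendsto.congr' ?_ hf
  refine eventually_inf_principal.mpr (Eventually.of_forall fun E hE => ?_)
  refine Finset.sum_congr rfl fun i hi => ?_
  rw [hfg (hE.1 i hi).1, hfg (hE.1 i hi).2]

/-! ### Replacing coefficients and arguments on a null set -/

section Congr

variable {m : ℕ} {a b h g : Fin m → ℝ → ℝ}

/-- Only values at almost every `t ≥ t₀ ≥ 0` enter the equation. The delayed term survives because
the arguments themselves agree at such `t`, whatever `x` is. -/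
theorem IsSolution.congr_ae {t₀ x₀ : ℝ} {φ : Set.Iio t₀ → ℝ} {x : ℝ → ℝ}
    (hx : IsSolution a h t₀ φ x₀ x) (ht₀ : 0 ≤ t₀)
    (hab : ∀ᵐ t ∂(volume.restrict (Set.Ici (0 : ℝ))), ∀ k, a k t = b k t ∧ h k t = g k t) :
    IsSolution b g t₀ φ x₀ x := by
  refine ⟨hx.absolutelyContinuous, ?_, hx.initial_function, hx.initial_value⟩
  filter_upwards [hx.equation, ae_restrict_of_ae_restrict_of_subset
    (Set.Ici_subset_Ici.mpr ht₀) hab] with t h1 h2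
  have : ∑ k, b k t * x (g k t) = ∑ k, a k t * x (h k t) :=
    Finset.sum_congr rfl fun k _ => by rw [(h2 k).1, (h2 k).2]
  rwa [this]

theorem AsymptoticallyStable.congr_ae (H : AsymptoticallyStable a h)
    (hab : ∀ᵐ t ∂(volume.restrict (Set.Ici (0 : ℝ))), ∀ k, b k t = a k t ∧ g k t = h k t) :
    AsymptoticallyStable b g := by
  refine ⟨fun t₀ ht₀ ε hε => ?_, fun t₀ ht₀ φ x₀ x hφ hx =>
    H.2 t₀ ht₀ φ x₀ x hφ (hx.congr_ae ht₀ hab)⟩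
  obtain ⟨δ, hδ, hδ'⟩ := H.1 t₀ ht₀ ε hε
  exact ⟨δ, hδ, fun φ x₀ x hφ hx => hδ' φ x₀ x hφ (hx.congr_ae ht₀ hab)⟩

theorem ExponentiallyStable.congr_ae (H : ExponentiallyStable a h)
    (hab : ∀ᵐ t ∂(volume.restrict (Set.Ici (0 : ℝ))), ∀ k, b k t = a k t ∧ g k t = h k t) :
    ExponentiallyStable b g := by
  obtain ⟨M, hM, μ, hμ, H⟩ := H
  exact ⟨M, hM, μ, hμ, fun t₀ ht₀ φ x₀ x hφ hx => H t₀ ht₀ φ x₀ x hφ (hx.congr_ae ht₀ hab)⟩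

/-- Essentially bounded nonnegative coefficients and delayed arguments on `[0, ∞)` agree almost
everywhere with Borel measurable ones that satisfy the bounds everywhere. -/
theorem exists_measurable_ae_eq
    (ha : ∀ k, MemLp (a k) ⊤ (volume.restrict (Set.Ici 0)))
    (hh_meas : ∀ k, AEMeasurable (h k) (volume.restrict (Set.Ici 0)))
    (hh_le : ∀ k, ∀ t : ℝ, 0 ≤ t → h k t ≤ t)
    (ha_nonneg : ∀ k, ∀ᵐ t ∂(volume.restrict (Set.Ici (0 : ℝ))), 0 ≤ a k t) :
    ∃ (b g : Fin m → ℝ → ℝ) (K : ℝ), 0 ≤ K ∧ (∀ k, Measurable (b k)) ∧ (∀ k, Measurable (g k)) ∧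
      (∀ k t, 0 ≤ b k t) ∧ (∀ t, ∑ k, b k t ≤ K) ∧ (∀ k t, g k t ≤ t) ∧
      ∀ᵐ t ∂(volume.restrict (Set.Ici (0 : ℝ))), ∀ k, a k t = b k t ∧ h k t = g k t := by
  have hbd : ∀ k, ∃ C : ℝ, 0 ≤ C ∧ ∀ᵐ t ∂(volume.restrict (Set.Ici (0 : ℝ))), ‖a k t‖ ≤ C :=
    fun k => by
      have hfin : eLpNormEssSup (a k) (volume.restrict (Set.Ici 0)) ≠ ⊤ := by
        simpa using (ha k).2.ne
      refine ⟨(eLpNormEssSup (a k) (volume.restrict (Set.Ici 0))).toReal, ENNReal.toReal_nonneg,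
        ?_⟩
      filter_upwards [enorm_ae_le_eLpNormEssSup (a k) (volume.restrict (Set.Ici 0))] with t ht
      simpa using ENNReal.toReal_mono hfin ht
  choose C hC0 hC using hbd
  have hm := fun k => (ha k).1.aemeasurable
  -- Truncating the measurable representatives makes the bounds hold at every real `t`; on `[0, ∞)`
  -- it changes them only on a null set.
  refine ⟨fun k t => max 0 (min ((hm k).mk _ t) (C k)), fun k t => min ((hh_meas k).mk _ t) t,
    ∑ k, C k, Finset.sum_nonneg fun k _ => hC0 k, fun k => ?_, fun k => ?_,
    fun k t => le_max_left _ _, fun t => ?_, fun k t => min_le_right _ _, ?_⟩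
  · exact measurable_const.max ((hm k).measurable_mk.min measurable_const)
  · exact (hh_meas k).measurable_mk.min measurable_id
  · exact Finset.sum_le_sum fun k _ => max_le (hC0 k) (min_le_right _ _)
  · filter_upwards [ae_all_iff.mpr hC, ae_all_iff.mpr ha_nonneg,
      ae_all_iff.mpr fun k => (hm k).ae_eq_mk, ae_all_iff.mpr fun k => (hh_meas k).ae_eq_mk,
      ae_restrict_mem measurableSet_Ici] with t h1 h2 h3 h4 h5 k
    rw [← h3 k, ← h4 k, min_eq_left (hh_le k t h5),
      min_eq_left ((le_abs_self _).trans (h1 k)), max_eq_right (h2 k)]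
    exact ⟨rfl, rfl⟩

end Congr

/-! ### Stability criteria for the ordinary equation -/

section ODE

variable {A : ℝ → ℝ}

/-- The explicit solution formula for a scalar linear ordinary differential equation. -/
theorem IsSolution.eq_mul_exp (hA : ∀ s t, IntervalIntegrable A volume s t) {t₀ x₀ : ℝ}
    {φ : Set.Iio t₀ → ℝ} {x : ℝ → ℝ} (hx : IsSolution (fun _ : Fin 1 => A) odeArg t₀ φ x₀ x)
    {t : ℝ} (ht : t₀ ≤ t) : x t = x₀ * Real.exp (-∫ s in t₀..t, A s) := by
  have hI : AbsolutelyContinuousOnInterval (fun u => ∫ s in t₀..u, A s) t₀ t :=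
    (hA t₀ t).absolutelyContinuousOnInterval_intervalIntegral (by simp)
  have hE : AbsolutelyContinuousOnInterval (fun u => Real.exp (∫ s in t₀..u, A s)) t₀ t := by
    -- The integral is bounded by `C` on the interval, and `exp` is Lipschitz on `(-∞, C]` with
    -- constant `exp C`; a Lipschitz function preserves absolute continuity.
    obtain ⟨C, hC⟩ := hI.exists_bound
    have hlip : ∀ u ∈ Set.uIcc t₀ t, ∀ v ∈ Set.uIcc t₀ t,
        dist (Real.exp (∫ s in t₀..u, A s)) (Real.exp (∫ s in t₀..v, A s)) ≤
          Real.exp C * dist (∫ s in t₀..u, A s) (∫ s in t₀..v, A s) := by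
      intro u hu v hv
      rw [Real.dist_eq, Real.dist_eq]
      refine Convex.norm_image_sub_le_of_norm_hasDerivWithin_le (s := Set.Iic C) (f := Real.exp)
        (f' := Real.exp) (fun y _ => (Real.hasDerivAt_exp y).hasDerivWithinAt) (fun y hy => ?_)
        (convex_Iic C) ((le_abs_self _).trans (hC v hv)) ((le_abs_self _).trans (hC u hu))
      rw [Real.norm_eq_abs, Real.abs_exp]
      exact Real.exp_le_exp.mpr hy
    refine squeeze_zero' (Eventually.of_forall fun E => Finset.sum_nonneg fun i _ => dist_nonneg)
      ?_ (by simpa using! Tendsto.const_mul (Real.exp C) hI)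
    refine eventually_inf_principal.mpr (Eventually.of_forall fun E hE => ?_)
    rw [Finset.mul_sum]
    exact Finset.sum_le_sum fun i hi => hlip _ (hE.1 i hi).1 _ (hE.1 i hi).2
  -- Integrating factor: the product is absolutely continuous with derivative zero almost
  -- everywhere, hence constant.
  have hder : ∀ᵐ u, u ∈ Set.uIcc t₀ t →
      HasDerivAt (fun u => x u * Real.exp (∫ s in t₀..u, A s)) 0 u := by
    have heq := (ae_restrict_iff' measurableSet_Ici).mp hx.equation
    filter_upwards [heq, (hA t₀ t).ae_hasDerivAt_integral] with u h1 h2 hu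
    have h3 := (h1 (Set.uIcc_of_le ht ▸ hu).1).mul (h2 hu t₀ (by simp)).exp
    refine h3.congr_deriv ?_
    simp only [odeArg, Finset.univ_unique, Finset.sum_const, Finset.card_singleton, one_smul]
    ring
  obtain ⟨C, hC⟩ := ((hx.absolutelyContinuous t ht).fun_mul hE).const_of_ae_hasDerivAt_zero hder
  have h0 := hC t₀ (by simp)
  have h1 := hC t (by simp)
  simp only [intervalIntegral.integral_same, Real.exp_zero, mul_one, hx.initial_value] at h0
  rw [Real.exp_neg, ← div_eq_mul_inv, eq_div_iff (Real.exp_ne_zero _), h1, h0]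

theorem asymptoticallyStable_ode (hA : ∀ s t, IntervalIntegrable A volume s t)
    (hA0 : ∀ t, 0 ≤ A t) (hdiv : Tendsto (fun t => ∫ s in (0 : ℝ)..t, A s) atTop atTop) :
    AsymptoticallyStable (fun _ : Fin 1 => A) odeArg := by
  refine ⟨fun t₀ ht₀ ε hε => ⟨ε, hε, fun φ x₀ x hφ hx hδ t ht => ?_⟩,
    fun t₀ ht₀ φ x₀ x hφ hx => ?_⟩
  · rw [hx.eq_mul_exp hA ht, abs_mul, Real.abs_exp]
    have h1 : Real.exp (-∫ s in t₀..t, A s) ≤ 1 := Real.exp_le_one_iff.mpr <|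
      neg_nonpos.mpr <| intervalIntegral.integral_nonneg ht fun s _ => hA0 s
    have h2 : 0 ≤ ⨆ t, |φ t| := Real.iSup_nonneg fun t => abs_nonneg _
    nlinarith [abs_nonneg x₀, mul_le_mul_of_nonneg_left h1 (abs_nonneg x₀)]
  · have h1 : Tendsto (fun t => ∫ s in t₀..t, A s) atTop atTop := by
      have : (fun t => ∫ s in t₀..t, A s) =
          fun t => (∫ s in t₀..0, A s) + ∫ s in (0 : ℝ)..t, A s := by
        funext t
        rw [intervalIntegral.integral_add_adjacent_intervals (hA _ _) (hA _ _)]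
      rw [this]
      exact tendsto_atTop_add_const_left _ _ hdiv
    have h2 : Tendsto (fun t => x₀ * Real.exp (-∫ s in t₀..t, A s)) atTop (𝓝 0) := by
      simpa using (Real.tendsto_exp_neg_atTop_nhds_zero.comp h1).const_mul x₀
    refine h2.congr' ?_
    filter_upwards [eventually_ge_atTop t₀] with t ht using (hx.eq_mul_exp hA ht).symm

theorem exponentiallyStable_ode (hA : ∀ s t, IntervalIntegrable A volume s t)
    (hA0 : ∀ t, 0 ≤ A t) {R c : ℝ} (hR : 0 < R) (hc : 0 < c)
    (hint : ∀ t, 0 ≤ t → c ≤ ∫ s in t..t + R, A s) :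
    ExponentiallyStable (fun _ : Fin 1 => A) odeArg := by
  have hmul : ∀ t, 0 ≤ t → ∀ n : ℕ, n * c ≤ ∫ s in t..t + n * R, A s := by
    intro t ht n
    induction n with
    | zero => simp
    | succ n ih =>
      have h1 := hint (t + n * R) (by positivity)
      have h2 := intervalIntegral.integral_add_adjacent_intervals (hA t (t + n * R))
        (hA (t + n * R) (t + n * R + R))
      have h3 : t + ((n + 1 : ℕ) : ℝ) * R = t + n * R + R := by push_cast; ring
      rw [h3, ← h2]
      push_cast
      linarith
  -- The rate is `c` per window of length `R`; the factor `exp c` pays for the last, incomplete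
  -- window.
  refine ⟨Real.exp c, Real.exp_pos _, c / R, div_pos hc hR, fun t₀ ht₀ φ x₀ x hφ hx t ht => ?_⟩
  have hlow : c / R * (t - t₀) - c ≤ ∫ s in t₀..t, A s := by
    have hq : 0 ≤ (t - t₀) / R := div_nonneg (sub_nonneg.mpr ht) hR.le
    have h1 : ⌊(t - t₀) / R⌋₊ * R ≤ t - t₀ := (le_div_iff₀ hR).mp (Nat.floor_le hq)
    have h2 := (Nat.lt_floor_add_one ((t - t₀) / R)).le
    have h3 := hmul t₀ ht₀ ⌊(t - t₀) / R⌋₊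
    have h4 := intervalIntegral.integral_add_adjacent_intervals
      (hA t₀ (t₀ + ⌊(t - t₀) / R⌋₊ * R)) (hA (t₀ + ⌊(t - t₀) / R⌋₊ * R) t)
    have h5 : 0 ≤ ∫ s in (t₀ + ⌊(t - t₀) / R⌋₊ * R)..t, A s :=
      intervalIntegral.integral_nonneg (by linarith) fun s _ => hA0 s
    have h6 : c / R * (t - t₀) = c * ((t - t₀) / R) := by ring
    rw [h6]
    nlinarith
  rw [hx.eq_mul_exp hA ht, abs_mul, Real.abs_exp, ← Real.exp_add, mul_comm]
  have h2 : 0 ≤ ⨆ t, |φ t| := Real.iSup_nonneg fun t => abs_nonneg _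
  refine mul_le_mul (Real.exp_le_exp.mpr (by linarith)) (by linarith) (abs_nonneg _)
    (Real.exp_pos _).le

end ODE

/-! ### The test solution: existence and lower bound -/

section Existence

variable {m : ℕ} {b g : Fin m → ℝ → ℝ} {K : ℝ}

/-- Extension by zero to the left of `t₀`, with the exponential weight removed. -/
noncomputable def unweight (L t₀ : ℝ) (y : ℝ → ℝ) (s : ℝ) : ℝ :=
  if s < t₀ then 0 else Real.exp (L * (s - t₀)) * y s

theorem measurable_unweight (L t₀ : ℝ) {y : ℝ → ℝ} (hy : Continuous y) :
    Measurable (unweight L t₀ y) :=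
  Measurable.ite measurableSet_Iio measurable_const
    (Continuous.measurable (by fun_prop))

theorem abs_unweight_le {L t₀ : ℝ} (hL : 0 ≤ L) (y : BoundedContinuousFunction ℝ ℝ) {r s : ℝ}
    (hrs : r ≤ s) : |unweight L t₀ y r| ≤ Real.exp (L * (s - t₀)) * ‖y‖ := by
  unfold unweight
  split_ifs with h
  · rw [abs_zero]; positivity
  · rw [abs_mul, Real.abs_exp]
    exact mul_le_mul (Real.exp_le_exp.mpr (by gcongr)) (y.norm_coe_le_norm r) (abs_nonneg _)
      (Real.exp_pos _).le

theorem abs_sum_unweight_le (hb0 : ∀ k t, 0 ≤ b k t) (hbK : ∀ t, ∑ k, b k t ≤ K)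
    (hg : ∀ k t, g k t ≤ t) {L t₀ : ℝ} (hL : 0 ≤ L) (y : BoundedContinuousFunction ℝ ℝ) (s : ℝ) :
    |∑ k, b k s * unweight L t₀ y (g k s)| ≤ K * ‖y‖ * Real.exp (L * (s - t₀)) := by
  calc |∑ k, b k s * unweight L t₀ y (g k s)|
      ≤ ∑ k, |b k s * unweight L t₀ y (g k s)| := Finset.abs_sum_le_sum_abs _ _
    _ ≤ ∑ k, b k s * (Real.exp (L * (s - t₀)) * ‖y‖) := Finset.sum_le_sum fun k _ => by
        rw [abs_mul, abs_of_nonneg (hb0 k s)]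
        exact mul_le_mul_of_nonneg_left (abs_unweight_le hL y (hg k s)) (hb0 k s)
    _ = (∑ k, b k s) * (Real.exp (L * (s - t₀)) * ‖y‖) := by rw [Finset.sum_mul]
    _ ≤ K * (Real.exp (L * (s - t₀)) * ‖y‖) :=
        mul_le_mul_of_nonneg_right (hbK s) (by positivity)
    _ = _ := by ring

theorem intervalIntegrable_sum_unweight (hbm : ∀ k, Measurable (b k))
    (hgm : ∀ k, Measurable (g k)) (hb0 : ∀ k t, 0 ≤ b k t) (hbK : ∀ t, ∑ k, b k t ≤ K)
    (hg : ∀ k t, g k t ≤ t) {L t₀ : ℝ} (hL : 0 ≤ L) (y : BoundedContinuousFunction ℝ ℝ)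
    (r s : ℝ) :
    IntervalIntegrable (fun s => ∑ k, b k s * unweight L t₀ y (g k s)) volume r s := by
  have hm : Measurable fun s => ∑ k, b k s * unweight L t₀ y (g k s) :=
    Finset.measurable_fun_sum _ fun k _ =>
      (hbm k).mul ((measurable_unweight L t₀ y.continuous).comp (hgm k))
  have hc : Continuous fun s => K * ‖y‖ * Real.exp (L * (s - t₀)) := by fun_prop
  exact (hc.intervalIntegrable r s).mono_fun' hm.aestronglyMeasurable
    (ae_of_all _ fun s => abs_sum_unweight_le hb0 hbK hg hL y s)

/-- Integrating the weight `exp (L * (s - t₀))` gains a factor `1 / L`, which makes the Picard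
operator contract for large `L`. -/
theorem abs_integral_sum_unweight_le (hb0 : ∀ k t, 0 ≤ b k t) (hbK : ∀ t, ∑ k, b k t ≤ K)
    (hg : ∀ k t, g k t ≤ t) (hK : 0 ≤ K) {L t₀ : ℝ} (hL : 0 < L)
    (y : BoundedContinuousFunction ℝ ℝ) {t : ℝ} (ht : t₀ ≤ t) :
    |∫ s in t₀..t, ∑ k, b k s * unweight L t₀ y (g k s)| ≤
      K / L * ‖y‖ * Real.exp (L * (t - t₀)) := by
  have hc : Continuous fun s => K * ‖y‖ * Real.exp (L * (s - t₀)) := by fun_prop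
  have h1 := intervalIntegral.norm_integral_le_of_norm_le ht
    (f := fun s => ∑ k, b k s * unweight L t₀ y (g k s))
    (ae_of_all volume fun s _ => abs_sum_unweight_le hb0 hbK hg hL.le y s)
    (hc.intervalIntegrable t₀ t)
  have h2 : ∫ s in t₀..t, K * ‖y‖ * Real.exp (L * (s - t₀)) =
      K / L * ‖y‖ * Real.exp (L * (t - t₀)) - K / L * ‖y‖ * Real.exp (L * (t₀ - t₀)) := by
    refine intervalIntegral.integral_eq_sub_of_hasDerivAt
      (f := fun s => K / L * ‖y‖ * Real.exp (L * (s - t₀))) (fun s _ => ?_)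
      (hc.intervalIntegrable t₀ t)
    refine ((((hasDerivAt_id s).sub_const t₀).const_mul L).exp.const_mul
      (K / L * ‖y‖)).congr_deriv ?_
    simp only [id]
    field_simp
  rw [h2] at h1
  have : 0 ≤ K / L * ‖y‖ * Real.exp (L * (t₀ - t₀)) := by positivity
  exact h1.trans (by linarith)

/-- The Picard operator in the exponentially weighted space. -/
theorem exists_picardOperator (hbm : ∀ k, Measurable (b k))
    (hgm : ∀ k, Measurable (g k)) (hb0 : ∀ k t, 0 ≤ b k t) (hbK : ∀ t, ∑ k, b k t ≤ K)
    (hg : ∀ k t, g k t ≤ t) (hK : 0 ≤ K) {L : ℝ} (hL : 0 < L) (t₀ : ℝ)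
    (y : BoundedContinuousFunction ℝ ℝ) :
    ∃ z : BoundedContinuousFunction ℝ ℝ, ∀ t, z t = Real.exp (-(L * (max t t₀ - t₀))) *
      (1 - ∫ s in t₀..max t t₀, ∑ k, b k s * unweight L t₀ y (g k s)) := by
  have hint := intervalIntegrable_sum_unweight hbm hgm hb0 hbK hg (t₀ := t₀) hL.le y
  have hcI : Continuous fun t => ∫ s in t₀..t, ∑ k, b k s * unweight L t₀ y (g k s) :=
    intervalIntegral.continuous_primitive hint t₀
  -- Freezing the value to the left of `t₀` through `max t t₀` keeps the operator within continuous
  -- functions on the whole line.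
  have hcont : Continuous fun t => Real.exp (-(L * (max t t₀ - t₀))) *
      (1 - ∫ s in t₀..max t t₀, ∑ k, b k s * unweight L t₀ y (g k s)) := by
    have hmax : Continuous fun t : ℝ => max t t₀ := by fun_prop
    exact (by fun_prop : Continuous fun t => Real.exp (-(L * (max t t₀ - t₀)))).mul
      (continuous_const.sub (hcI.comp hmax))
  refine ⟨BoundedContinuousFunction.ofNormedAddCommGroup _ hcont (1 + K / L * ‖y‖)
    fun t => ?_, fun t => rfl⟩
  have h1 := abs_integral_sum_unweight_le hb0 hbK hg hK hL y (le_max_right t t₀)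
  have h2 : 0 ≤ L * (max t t₀ - t₀) :=
    mul_nonneg hL.le (sub_nonneg.mpr (le_max_right t t₀))
  rw [Real.norm_eq_abs, abs_mul, Real.abs_exp]
  calc _ ≤ Real.exp (-(L * (max t t₀ - t₀))) *
        (1 + K / L * ‖y‖ * Real.exp (L * (max t t₀ - t₀))) := by
        gcongr
        refine (abs_sub _ _).trans ?_
        rw [abs_one]
        gcongr
    _ = Real.exp (-(L * (max t t₀ - t₀))) + K / L * ‖y‖ * (Real.exp (-(L * (max t t₀ - t₀))) *
          Real.exp (L * (max t t₀ - t₀))) := by ring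
    _ ≤ 1 + K / L * ‖y‖ := by
        rw [← Real.exp_add, neg_add_cancel, Real.exp_zero, mul_one]
        gcongr
        exact Real.exp_le_one_iff.mpr (neg_nonpos.mpr h2)

/-- The integral equation with zero prehistory and initial value one has a solution. -/
theorem exists_integral_solution (hbm : ∀ k, Measurable (b k))
    (hgm : ∀ k, Measurable (g k)) (hb0 : ∀ k t, 0 ≤ b k t) (hbK : ∀ t, ∑ k, b k t ≤ K)
    (hg : ∀ k t, g k t ≤ t) (hK : 0 ≤ K) (t₀ : ℝ) :
    ∃ x : ℝ → ℝ, (∀ t < t₀, x t = 0) ∧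
      (∀ r s, IntervalIntegrable (fun s => ∑ k, b k s * x (g k s)) volume r s) ∧
      ∀ t, t₀ ≤ t → x t = 1 - ∫ s in t₀..t, ∑ k, b k s * x (g k s) := by
  obtain ⟨L, hL, hKL⟩ : ∃ L : ℝ, 0 < L ∧ K / L ≤ 1 / 2 := by
    refine ⟨2 * K + 1, by linarith, ?_⟩
    rw [div_le_div_iff₀ (by linarith) (by norm_num)]
    linarith
  choose T hT using exists_picardOperator hbm hgm hb0 hbK hg hK hL t₀
  have hlip : ContractingWith (1 / 2) T := by
    refine ⟨by rw [← NNReal.coe_lt_coe]; norm_num, LipschitzWith.of_dist_le_mul fun y z => ?_⟩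
    rw [BoundedContinuousFunction.dist_le (by positivity)]
    intro t
    have hsub : (∫ s in t₀..max t t₀, ∑ k, b k s * unweight L t₀ z (g k s)) -
        (∫ s in t₀..max t t₀, ∑ k, b k s * unweight L t₀ y (g k s)) =
        ∫ s in t₀..max t t₀, ∑ k, b k s * unweight L t₀ (z - y : BoundedContinuousFunction ℝ ℝ)
          (g k s) := by
      rw [← intervalIntegral.integral_sub
        (intervalIntegrable_sum_unweight hbm hgm hb0 hbK hg hL.le z _ _)
        (intervalIntegrable_sum_unweight hbm hgm hb0 hbK hg hL.le y _ _)]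
      refine intervalIntegral.integral_congr fun s _ => ?_
      rw [← Finset.sum_sub_distrib]
      refine Finset.sum_congr rfl fun k _ => ?_
      rw [← mul_sub]
      congr 1
      unfold unweight
      split_ifs
      · simp
      · rw [BoundedContinuousFunction.coe_sub, Pi.sub_apply]; ring
    have h1 := abs_integral_sum_unweight_le hb0 hbK hg hK hL (z - y) (le_max_right t t₀)
    rw [hT, hT, Real.dist_eq, ← mul_sub, sub_sub_sub_cancel_left, hsub, abs_mul, Real.abs_exp]
    calc _ ≤ Real.exp (-(L * (max t t₀ - t₀))) *
          (K / L * ‖z - y‖ * Real.exp (L * (max t t₀ - t₀))) := by gcongr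
      _ = K / L * ‖z - y‖ * (Real.exp (-(L * (max t t₀ - t₀))) *
          Real.exp (L * (max t t₀ - t₀))) := by ring
      _ = K / L * ‖z - y‖ := by rw [← Real.exp_add, neg_add_cancel, Real.exp_zero, mul_one]
      _ ≤ _ := by
        rw [dist_eq_norm, norm_sub_rev]
        refine mul_le_mul_of_nonneg_right (hKL.trans ?_) (norm_nonneg _)
        norm_num
  let y := ContractingWith.fixedPoint T hlip
  have hy : T y = y := hlip.fixedPoint_isFixedPt
  refine ⟨unweight L t₀ y, fun t ht => if_pos ht,
    intervalIntegrable_sum_unweight hbm hgm hb0 hbK hg hL.le y, fun t ht => ?_⟩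
  have h1 := hT y t
  rw [hy, max_eq_left ht] at h1
  rw [unweight, if_neg ht.not_gt, h1, ← mul_assoc, ← Real.exp_add, add_neg_cancel, Real.exp_zero,
    one_mul]

theorem isSolution_of_integral_eq {t₀ : ℝ} {x : ℝ → ℝ} (hx0 : ∀ t < t₀, x t = 0)
    (hint : ∀ r s, IntervalIntegrable (fun s => ∑ k, b k s * x (g k s)) volume r s)
    (hx : ∀ t, t₀ ≤ t → x t = 1 - ∫ s in t₀..t, ∑ k, b k s * x (g k s)) :
    IsSolution b g t₀ (fun _ => 0) 1 x := by
  refine ⟨fun T hT => ?_, ?_, fun t => hx0 t t.2, by simp [hx t₀ le_rfl]⟩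
  · have hone : AbsolutelyContinuousOnInterval (fun _ : ℝ => (1 : ℝ)) t₀ T :=
      ((LipschitzWith.const (1 : ℝ)).lipschitzOnWith).absolutelyContinuousOnInterval
    refine (hone.fun_sub ((hint t₀ T).absolutelyContinuousOnInterval_intervalIntegral
      (c := t₀) (by simp))).congr fun t ht => ?_
    exact (hx t (Set.uIcc_of_le hT ▸ ht).1).symm
  · have hli : LocallyIntegrable (fun s => ∑ k, b k s * x (g k s)) volume :=
      fun t => ⟨Set.Ioc (t - 1) (t + 1), Ioc_mem_nhds (by linarith) (by linarith),
        (hint (t - 1) (t + 1)).1⟩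
    -- The solution jumps from 0 to 1 at `t₀`, so this point is excluded.
    have hne : ∀ᵐ t : ℝ, t ≠ t₀ := by simp [ae_iff, measure_singleton]
    rw [ae_restrict_iff' measurableSet_Ici]
    filter_upwards [LocallyIntegrable.ae_hasDerivAt_integral hli, hne] with t h1 h2 ht
    have h3 := (h1 t₀).const_sub 1
    refine h3.congr_of_eventuallyEq ?_
    filter_upwards [lt_mem_nhds (lt_of_le_of_ne ht (Ne.symm h2))] with s hs using hx s hs.le

/-- While the integral of the coefficients is at most `1 / 4`, the solution stays above `2 / 3`. -/
theorem two_thirds_le_of_integral_le {t₀ : ℝ} {x : ℝ → ℝ} (hb0 : ∀ k t, 0 ≤ b k t)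
    (hg : ∀ k t, g k t ≤ t) (hB : ∀ r s, IntervalIntegrable (fun s => ∑ k, b k s) volume r s)
    (hx0 : ∀ t < t₀, x t = 0)
    (hint : ∀ r s, IntervalIntegrable (fun s => ∑ k, b k s * x (g k s)) volume r s)
    (hx : ∀ t, t₀ ≤ t → x t = 1 - ∫ s in t₀..t, ∑ k, b k s * x (g k s))
    {T : ℝ} (hT : t₀ ≤ T) (hI : ∫ s in t₀..T, ∑ k, b k s ≤ 1 / 4) : 2 / 3 ≤ x T := by
  have hcont : ContinuousOn x (Set.Icc t₀ T) :=
    (continuous_const.sub (intervalIntegral.continuous_primitive hint t₀)).continuousOn.congr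
      fun t ht => hx t ht.1
  obtain ⟨p, hp, hmax⟩ := isCompact_Icc.exists_isMaxOn (Set.nonempty_Icc.mpr hT) hcont.abs
  -- Delayed values lie in `[t₀, T]` or in the zero prehistory, so all are bounded by the maximum
  -- `|x p|`. Taking `t = p` gives `|x p| ≤ 1 + |x p| / 4`, so `|x p| ≤ 4 / 3` and the deviation
  -- from 1 is at most 1/3.
  have hdev : ∀ t ∈ Set.Icc t₀ T, |x t - 1| ≤ 1 / 4 * |x p| := by
    intro t ht
    rw [hx t ht.1, sub_sub_cancel_left, abs_neg]
    have hle : ∀ s ∈ Set.Ioc t₀ t, ‖∑ k, b k s * x (g k s)‖ ≤ (∑ k, b k s) * |x p| := by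
      intro s hs
      rw [Finset.sum_mul]
      refine (norm_sum_le _ _).trans (Finset.sum_le_sum fun k _ => ?_)
      rw [norm_mul, Real.norm_of_nonneg (hb0 k s)]
      refine mul_le_mul_of_nonneg_left ?_ (hb0 k s)
      rcases lt_or_ge (g k s) t₀ with h | h
      · rw [hx0 _ h, norm_zero]; exact abs_nonneg _
      · exact hmax ⟨h, (hg k s).trans (hs.2.trans ht.2)⟩
    have h1 := intervalIntegral.norm_integral_le_of_norm_le ht.1
      (ae_of_all volume hle) ((hB t₀ t).mul_const _)
    rw [intervalIntegral.integral_mul_const] at h1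
    refine h1.trans (mul_le_mul_of_nonneg_right (le_trans ?_ hI) (abs_nonneg _))
    have h2 := intervalIntegral.integral_add_adjacent_intervals (hB t₀ t) (hB t T)
    have h3 : 0 ≤ ∫ s in t..T, ∑ k, b k s :=
      intervalIntegral.integral_nonneg ht.2 fun s _ => Finset.sum_nonneg fun k _ => hb0 k s
    linarith
  have hp1 : |x p| ≤ 4 / 3 := by
    have h1 := hdev p hp
    have h2 := abs_sub_abs_le_abs_sub (x p) 1
    rw [abs_one] at h2
    linarith
  have h1 := (abs_le.mp (hdev T ⟨hT, le_rfl⟩)).1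
  linarith

end Existence

theorem isInitialFunction_zero (t₀ : ℝ) : IsInitialFunction t₀ (fun _ => 0) :=
  ⟨measurable_const, 0, fun t => by simp⟩

/-! ### From stability of the delay equation to the ordinary one -/

section Main

variable {m : ℕ} {b g : Fin m → ℝ → ℝ} {K : ℝ}

theorem intervalIntegrable_sum_coeff (hbm : ∀ k, Measurable (b k)) (hb0 : ∀ k t, 0 ≤ b k t)
    (hbK : ∀ t, ∑ k, b k t ≤ K) (r s : ℝ) :
    IntervalIntegrable (fun s => ∑ k, b k s) volume r s := by
  refine (continuous_const (y := K)).intervalIntegrable r s |>.mono_fun'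
    (Finset.measurable_fun_sum _ fun k _ => hbm k).aestronglyMeasurable (ae_of_all _ fun t => ?_)
  exact (Real.norm_of_nonneg (Finset.sum_nonneg fun k _ => hb0 k t)).trans_le (hbK t)

theorem AsymptoticallyStable.ode (hbm : ∀ k, Measurable (b k))
    (hgm : ∀ k, Measurable (g k)) (hb0 : ∀ k t, 0 ≤ b k t) (hbK : ∀ t, ∑ k, b k t ≤ K)
    (hg : ∀ k t, g k t ≤ t) (hK : 0 ≤ K) (H : AsymptoticallyStable b g) :
    AsymptoticallyStable (odeCoeff b) odeArg := by
  have hB := intervalIntegrable_sum_coeff hbm hb0 hbK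
  have hB0 : ∀ t, 0 ≤ ∑ k, b k t := fun t => Finset.sum_nonneg fun k _ => hb0 k t
  refine asymptoticallyStable_ode hB hB0 ?_
  have hmono : Monotone fun t => ∫ s in (0 : ℝ)..t, ∑ k, b k s := by
    intro s t hst
    have h2 := intervalIntegral.integral_add_adjacent_intervals (hB 0 s) (hB s t)
    have h3 := intervalIntegral.integral_nonneg (μ := volume) hst fun s _ => hB0 s
    simp only
    linarith
  -- A monotone integral that does not diverge has a limit `l`; beyond a suitable `t₀` its tail is
  -- below 1/4, which keeps the test solution above 2/3 forever.
  refine (tendsto_atTop_of_monotone hmono).resolve_right ?_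
  rintro ⟨l, hl⟩
  obtain ⟨t₀, ht₀, hlt⟩ : ∃ t₀, 0 ≤ t₀ ∧ l - 1 / 4 < ∫ s in (0 : ℝ)..t₀, ∑ k, b k s :=
    ((eventually_ge_atTop 0).and (hl.eventually (lt_mem_nhds (by linarith)))).exists
  obtain ⟨x, hx0, hint, hx⟩ := exists_integral_solution hbm hgm hb0 hbK hg hK t₀
  have hlim := H.2 t₀ ht₀ _ _ x (isInitialFunction_zero t₀) (isSolution_of_integral_eq hx0 hint hx)
  have hge : ∀ᶠ t in atTop, 2 / 3 ≤ x t := by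
    filter_upwards [eventually_ge_atTop t₀] with t ht
    refine two_thirds_le_of_integral_le hb0 hg hB hx0 hint hx ht ?_
    have h1 := intervalIntegral.integral_add_adjacent_intervals (hB 0 t₀) (hB t₀ t)
    have h2 := hmono.ge_of_tendsto hl t
    linarith
  have := ge_of_tendsto hlim hge
  norm_num at this

theorem ExponentiallyStable.ode (hbm : ∀ k, Measurable (b k))
    (hgm : ∀ k, Measurable (g k)) (hb0 : ∀ k t, 0 ≤ b k t) (hbK : ∀ t, ∑ k, b k t ≤ K)
    (hg : ∀ k t, g k t ≤ t) (hK : 0 ≤ K) (H : ExponentiallyStable b g) :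
    ExponentiallyStable (odeCoeff b) odeArg := by
  have hB := intervalIntegrable_sum_coeff hbm hb0 hbK
  have hB0 : ∀ t, 0 ≤ ∑ k, b k t := fun t => Finset.sum_nonneg fun k _ => hb0 k t
  obtain ⟨M, hM, μ, hμ, H⟩ := H
  -- `R` is chosen so that the exponential bound falls below 2/3 after time `R`. It is independent
  -- of `t₀` because `M` and `μ` are.
  obtain ⟨R, hR, hMR⟩ : ∃ R : ℝ, 0 < R ∧ M * Real.exp (-μ * R) < 2 / 3 := by
    have h1 : Tendsto (fun R : ℝ => M * Real.exp (-(μ * R))) atTop (𝓝 (M * 0)) :=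
      (Real.tendsto_exp_neg_atTop_nhds_zero.comp
        (tendsto_id.const_mul_atTop hμ)).const_mul M
    obtain ⟨R, hR, hR'⟩ := ((eventually_gt_atTop 0).and
      (h1.eventually (gt_mem_nhds (by norm_num : M * 0 < 2 / 3)))).exists
    exact ⟨R, hR, by rwa [neg_mul]⟩
  refine exponentiallyStable_ode hB hB0 hR (c := 1 / 4) (by norm_num) fun t₀ ht₀ => ?_
  by_contra! hlt
  obtain ⟨x, hx0, hint, hx⟩ := exists_integral_solution hbm hgm hb0 hbK hg hK t₀
  have h1 := H t₀ ht₀ _ _ x (isInitialFunction_zero t₀) (isSolution_of_integral_eq hx0 hint hx)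
    (t₀ + R) (by linarith)
  have h2 := two_thirds_le_of_integral_le hb0 hg hB hx0 hint hx (by linarith) hlt.le
  simp only [add_sub_cancel_left, abs_one, abs_zero, ciSup_const, add_zero, mul_one] at h1
  linarith [le_abs_self (x (t₀ + R))]

end Main

end DelayEq

theorem theorem5 (m : ℕ) (a h : Fin m → ℝ → ℝ)
    (ha : ∀ k, MemLp (a k) ⊤ (volume.restrict (Set.Ici 0)))
    (hh_meas : ∀ k, AEMeasurable (h k) (volume.restrict (Set.Ici 0)))
    (hh_le : ∀ k, ∀ t : ℝ, 0 ≤ t → h k t ≤ t)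
    (hh_limsup : ∀ k, limsup (fun t : ℝ => (h k t : EReal)) atTop = ⊤)
    (ha_nonneg : ∀ k, ∀ᵐ t ∂(volume.restrict (Set.Ici (0 : ℝ))), 0 ≤ a k t) :
    (DelayEq.AsymptoticallyStable a h →
      DelayEq.AsymptoticallyStable (DelayEq.odeCoeff a) DelayEq.odeArg) ∧
    ((∀ k, limsup (fun t : ℝ => ((t - h k t : ℝ) : EReal)) atTop < ⊤) →
      DelayEq.ExponentiallyStable a h →
        DelayEq.ExponentiallyStable (DelayEq.odeCoeff a) DelayEq.odeArg) := by
  -- Borel representatives are needed because the test solution is discontinuous and is composed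
  -- with the delayed arguments.
  obtain ⟨b, g, K, hK, hbm, hgm, hb0, hbK, hg, hab⟩ :=
    DelayEq.exists_measurable_ae_eq ha hh_meas hh_le ha_nonneg
  have hba : ∀ᵐ t ∂(volume.restrict (Set.Ici (0 : ℝ))), ∀ k, b k t = a k t ∧ g k t = h k t :=
    hab.mono fun t ht k => ⟨(ht k).1.symm, (ht k).2.symm⟩
  have hode : ∀ᵐ t ∂(volume.restrict (Set.Ici (0 : ℝ))), ∀ k,
      DelayEq.odeCoeff a k t = DelayEq.odeCoeff b k t ∧ DelayEq.odeArg k t = DelayEq.odeArg k t :=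
    hab.mono fun t ht k => ⟨Finset.sum_congr rfl fun j _ => (ht j).1, rfl⟩
  exact ⟨fun H => ((H.congr_ae hba).ode hbm hgm hb0 hbK hg hK).congr_ae hode,
    fun _ H => ((H.congr_ae hba).ode hbm hgm hb0 hbK hg hK).congr_ae hode⟩
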